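/- **Theorem 2.10.** Let $\mathbf F$ be the $n\times n$ discrete Fourier transform matrix, with entries $\mathbf F_{jt}=n^{-1/2}e^{-2\pi i jt/n}$ for $j,t\in\{1,\dots,n\}$. For an $n\times n$ complex matrix $A$ and sets $\Omega,T\subset\{1,\dots,n\}$, let $A_{\Omega T}$ denote the restriction of $A$ to the rows listed in $\Omega$ and the columns listed in $T$, and let $\|\cdot\|$ denote the spectral norm (the $\ell_2\to\ell_2$ operator norm). A random set of cardinality $m$ is a set drawn uniformly at random from all $m$-element subsets of $\{1,\dots,n\}$. There is an absolute constant $c>0$ such that for every $C>0$ and every $\delta\in(0,c)$ there is a number $N=N(\delta,C)$ with the following property. Let $n\ge N$, and let $\Omega$ and $T$ be independent random sets with fixed cardinalities satisfying $$|T|\le|\Omega|=\delta n .$$ Then $$\mathbb P\left\{\sqrt{\frac{n}{|\Omega|}}\;\|\mathbf F_{\Omega T}\|\ge 9\right\}\le n^{-C}.$$ Moreover, with the same $c$ and $N$, for every $n\times n$ complex matrix $A$ with $\|A\|\le 1$ and $|a_{\omega t}|\le n^{-1/2}$ for all $\omega,t$, $$\mathbb P\left\{\sqrt{\frac{n}{|\Omega|}}\;\|A_{\Omega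 T}\|\ge 9\right\}\le n^{-C}.$$ -/

import Mathlib

open scoped Matrix.Norms.L2Operator

noncomputable section

namespace SpikesSines

/-- The index `i : Fin n` stands for the element `i + 1` of `{1, 2, …, n}`. The Fourier basis vector
`f_j(t) = n^{-1/2} e^{2π i j t / n}`. -/
def fourierVec (n : ℕ) (j t : Fin n) : ℂ :=
  (1 / (Real.sqrt (n : ℝ) : ℂ)) *
    Complex.exp (2 * Real.pi * Complex.I * ((j : ℕ) + 1) * ((t : ℕ) + 1) / n)

/-- The `n × n` discrete Fourier transform matrix, whose rows are the conjugate transposes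
`f_1^*, …, f_n^*`. -/
def dftMatrix (n : ℕ) : Matrix (Fin n) (Fin n) ℂ :=
  Matrix.of fun j t => star (fourierVec n j t)

/-- The restriction `A_{ΩT}` of `A` to the rows listed in `Ω` and the columns listed in `T`. -/
def restrict {n : ℕ} (A : Matrix (Fin n) (Fin n) ℂ) (Ω T : Finset (Fin n)) : Matrix Ω T ℂ :=
  A.submatrix (fun i => (i : Fin n)) (fun j => (j : Fin n))

/-- The law of a random set with cardinality `m`: the uniform distribution on the subsets of
`{1, …, n}` that have exactly `m` elements. -/
def randomSet (n m : ℕ) : MeasureTheory.Measure (Finset (Fin n)) :=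
  ProbabilityTheory.uniformOn {S : Finset (Fin n) | S.card = m}

/-- The probability `P(√(n / |Ω|) ‖A_{ΩT}‖ ≥ u)` where `Ω` and `T` are independent random sets with
cardinalities `k` and `l`, and the norm is the spectral norm (the `ℓ₂ → ℓ₂` operator norm). -/
def normTailProb {n : ℕ} (A : Matrix (Fin n) (Fin n) ℂ) (k l : ℕ) (u : ℝ) : ℝ :=
  ((randomSet n k).prod (randomSet n l)).real
    {p | u ≤ Real.sqrt ((n : ℝ) / (p.1.card : ℝ)) * ‖restrict A p.1 p.2‖}

end SpikesSines

end

/-! The proof is the moment method, with polynomial extrapolation in place of cancellation between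
walks. Write `|Ω| = δn`, `|T| = θ|Ω|`. The uniform law on sets of fixed size is at most `n + 1`
times the law of independent selectors with the same mean size (`randomSet_real_singleton_le`), so
it suffices to bound the selector mean of `tr (A_{ΩT} A_{ΩT}^*)^p` for `p` of order `log n`.

With rates `s` and `θs` this mean is a polynomial in `s` of degree at most `2p`. On all of `[0, 1]`
it is bounded by `n`, because `‖A‖ ≤ 1`. Its coefficients below degree `p - q` have a tiny total
`ε`: a pair of index tuples has weight at most `n · n^{-p}`, and few pairs have so few distinct
entries. Chebyshev extremality bounds the sum of the remaining coefficients by `36^p (n + ε)`, so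
the mean is at most `ε + s^{p-q} 36^p (n + ε)` (`selectorMean_traceMoment_le`).

Markov's inequality divides this by `(81δ)^p`. Taking `p = rq` with `δ^{-1} ≤ (3/2)^r` leaves the
ratio `36 · (3/2) / 81 = 2/3` to the power `p`, and `q` of order `log n` beats every polynomial
factor (`tail_estimate`). The Fourier matrix is a special case: it is unitary with entries of
modulus `n^{-1/2}`. -/

namespace SpikesSines

/-! ### Coefficient bounds for bounded polynomials, and extrapolation to small arguments. -/

section Chebyshev

open Polynomial

/-- The recurrence at 3 multiplies by 6 and subtracts a positive term. The point is `3 = 1 + 2`: the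
coefficient bounds below sum to the Taylor expansion of `T_d` about 1, evaluated at 2. -/
theorem chebyshev_eval_three_le (m : ℕ) : (Chebyshev.T ℝ m).eval 3 ≤ 6 ^ m := by
  induction m with
  | zero => simp
  | succ m ih =>
    rcases m with _ | m
    · norm_num
    · have h1 : (1 : ℝ) ≤ (Chebyshev.T ℝ (m : ℤ)).eval 3 :=
        Chebyshev.one_le_eval_T_real _ (by norm_num)
      have h2 := congrArg (eval 3) (Chebyshev.T_add_two ℝ (m : ℤ))
      simp only [eval_sub, eval_mul, eval_ofNat, eval_X] at h2
      push_cast at ih ⊢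
      rw [show (m : ℤ) + 1 + 1 = m + 2 by ring, h2, pow_succ _ (m + 1)]
      linarith

/-- A real polynomial of degree at most `d` that is bounded by `M` on `[0, 1]` has coefficients
whose absolute values sum to at most `6 ^ d * M`. -/
theorem sum_abs_coeff_le {d : ℕ} {P : ℝ[X]} {M : ℝ} (hd : P.natDegree ≤ d) (hM : 0 < M)
    (hP : ∀ x ∈ Set.Icc (0 : ℝ) 1, |P.eval x| ≤ M) :
    ∑ k ∈ Finset.range (d + 1), |P.coeff k| ≤ 6 ^ d * M := by
  have key : ∀ R : ℝ[X], R.natDegree ≤ d → (∀ x ∈ Set.Icc (0 : ℝ) 1, |R.eval x| ≤ 1) →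
      ∀ k, (-(1 / 2)) ^ k * R.coeff k ≤ (taylor 1 (Chebyshev.T ℝ d)).coeff k := by
    intro R hR hR1 k
    -- This substitution carries `[-1, 1]` to `[0, 1]` and 1 to 0, so the coefficients of `R` become
    -- Taylor coefficients at the endpoint where `T_d` maximizes every derivative.
    set Q : ℝ[X] := R.comp (C (-(1 / 2)) * X + C (1 / 2)) with hQ
    have hdeg : Q.degree ≤ d := by
      refine degree_le_of_natDegree_le (natDegree_comp_le.trans ?_)
      calc R.natDegree * (C (-(1 / 2) : ℝ) * X + C (1 / 2)).natDegree
          ≤ d * 1 := Nat.mul_le_mul hR (natDegree_linear_le)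
        _ = d := mul_one d
    have hb : ∀ x ∈ Set.Icc (-1 : ℝ) 1, |Q.eval x| ≤ 1 := by
      rintro x ⟨hx1, hx2⟩
      rw [hQ, eval_comp]
      apply hR1
      simp only [eval_add, eval_mul, eval_C, eval_X]
      constructor <;> linarith
    have h := Chebyshev.eval_iterate_derivative_le_of_forall_abs_le_one (k := k) le_rfl hdeg hb
    have ht : taylor 1 Q = R.comp (C (-(1 / 2)) * X) := by
      rw [taylor_apply, hQ, comp_assoc]
      congr 1
      simp only [add_comp, mul_comp, C_comp, X_comp, mul_add, ← C_mul, add_assoc, ← C_add]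
      norm_num
    have hc : (-(1 / 2)) ^ k * R.coeff k = (taylor 1 Q).coeff k := by
      rw [ht, comp_C_mul_X_coeff, mul_comm]
    rw [hc, taylor_coeff, taylor_coeff]
    have hf : ∀ S : ℝ[X], eval 1 (derivative^[k] S) = k.factorial * eval 1 (hasseDeriv k S) := by
      intro S
      rw [← factorial_smul_hasseDeriv]
      simp
    rw [hf, hf] at h
    exact le_of_mul_le_mul_left h (by positivity)
  have habs : ∀ k, |P.coeff k| ≤ M * ((taylor 1 (Chebyshev.T ℝ d)).coeff k * 2 ^ k) := by
    intro k
    have h1 := key (C M⁻¹ * P) ((natDegree_C_mul_le _ _).trans hd) (by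
      intro x hx
      rw [eval_mul, eval_C, abs_mul, abs_of_pos (inv_pos.2 hM)]
      exact (inv_mul_le_one₀ hM).2 (hP x hx)) k
    have h2 := key (C (-M⁻¹) * P) ((natDegree_C_mul_le _ _).trans hd) (by
      intro x hx
      rw [eval_mul, eval_C, abs_mul, abs_neg, abs_of_pos (inv_pos.2 hM)]
      exact (inv_mul_le_one₀ hM).2 (hP x hx)) k
    rw [coeff_C_mul] at h1 h2
    have h3 : |(-(1 / 2)) ^ k * (M⁻¹ * P.coeff k)| ≤ (taylor 1 (Chebyshev.T ℝ d)).coeff k :=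
      abs_le.2 ⟨by linarith, h1⟩
    rw [abs_mul, abs_pow, abs_neg, abs_mul, abs_of_pos (inv_pos.2 hM),
      abs_of_pos (by norm_num : (0 : ℝ) < 1 / 2), one_div, inv_pow] at h3
    have h4 : |P.coeff k| = M * (((2 ^ k)⁻¹ * (M⁻¹ * |P.coeff k|)) * 2 ^ k) := by
      field_simp
    rw [h4]
    gcongr
  calc ∑ k ∈ Finset.range (d + 1), |P.coeff k|
      ≤ ∑ k ∈ Finset.range (d + 1), M * ((taylor 1 (Chebyshev.T ℝ d)).coeff k * 2 ^ k) :=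
        Finset.sum_le_sum fun k _ => habs k
    _ = M * (taylor 1 (Chebyshev.T ℝ d)).eval 2 := by
        rw [← Finset.mul_sum, eval_eq_sum_range' (n := d + 1)]
        rw [natDegree_taylor, Chebyshev.natDegree_T]
        simp
    _ ≤ M * 6 ^ d := by
        rw [taylor_eval]
        norm_num
        gcongr
        exact chebyshev_eval_three_le d
    _ = 6 ^ d * M := mul_comm _ _

/-- Extrapolation: a sum of monomials of degree at most `d` that is bounded by `M` on `[0, 1]`, and
whose coefficients in degrees below `m` are small, is of order `s ^ m` near zero. -/
theorem sum_mul_pow_le_of_bounded {ι : Type*} [Fintype ι] (c : ι → ℝ) (e : ι → ℕ) {d m : ℕ}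
    {ε M : ℝ} (he : ∀ i, e i ≤ d) (hM : 0 < M)
    (hlow : ∑ i with e i < m, |c i| ≤ ε)
    (hb : ∀ s ∈ Set.Icc (0 : ℝ) 1, |∑ i, c i * s ^ e i| ≤ M) {s : ℝ} (hs : s ∈ Set.Icc (0 : ℝ) 1) :
    ∑ i, c i * s ^ e i ≤ ε + s ^ m * (6 ^ d * (M + ε)) := by
  have hε : 0 ≤ ε := (Finset.sum_nonneg fun i _ => abs_nonneg (c i)).trans hlow
  -- The part of degree at least `m`: it inherits the bound `M + ε` on `[0, 1]`, and `s ^ m` factors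
  -- out of it.
  set P : ℝ[X] := ∑ i with ¬ e i < m, C (c i) * X ^ e i with hPdef
  have hev : ∀ x : ℝ, P.eval x = ∑ i with ¬ e i < m, c i * x ^ e i := by
    intro x
    simp [hPdef, eval_finsetSum]
  have hsplit : ∀ x : ℝ, ∑ i, c i * x ^ e i = ∑ i with e i < m, c i * x ^ e i + P.eval x := by
    intro x
    rw [hev, Finset.sum_filter_add_sum_filter_not]
  have hlow' : ∀ x ∈ Set.Icc (0 : ℝ) 1, |∑ i with e i < m, c i * x ^ e i| ≤ ε := by
    intro x hx
    refine (Finset.abs_sum_le_sum_abs _ _).trans (le_trans (Finset.sum_le_sum fun i _ => ?_) hlow)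
    rw [abs_mul, abs_pow, abs_of_nonneg hx.1]
    exact mul_le_of_le_one_right (abs_nonneg _) (pow_le_one₀ hx.1 hx.2)
  have hdeg : P.natDegree ≤ d := by
    refine natDegree_sum_le_of_forall_le _ _ fun i _ => ?_
    exact (natDegree_C_mul_X_pow_le _ _).trans (he i)
  have hPb : ∀ x ∈ Set.Icc (0 : ℝ) 1, |P.eval x| ≤ M + ε := by
    intro x hx
    have h1 := abs_le.1 (hb x hx)
    have h2 := abs_le.1 (hlow' x hx)
    have h3 := hsplit x
    exact abs_le.2 ⟨by linarith, by linarith⟩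
  have hcoeff := sum_abs_coeff_le hdeg (by linarith) hPb
  have hzero : ∀ k < m, P.coeff k = 0 := by
    intro k hk
    simp only [hPdef, finsetSum_coeff, coeff_C_mul, coeff_X_pow]
    refine Finset.sum_eq_zero fun i hi => ?_
    rw [if_neg, mul_zero]
    have := (Finset.mem_filter.1 hi).2
    omega
  have hPs : P.eval s ≤ s ^ m * (6 ^ d * (M + ε)) := by
    rw [eval_eq_sum_range' (Nat.lt_succ_of_le hdeg)]
    calc ∑ k ∈ Finset.range (d + 1), P.coeff k * s ^ k
        ≤ ∑ k ∈ Finset.range (d + 1), s ^ m * |P.coeff k| := by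
          refine Finset.sum_le_sum fun k _ => ?_
          by_cases hk : k < m
          · simp [hzero k hk]
          · rw [mul_comm]
            have h1 : s ^ k ≤ s ^ m := pow_le_pow_of_le_one hs.1 hs.2 (not_lt.1 hk)
            have h2 : 0 ≤ s ^ k := pow_nonneg hs.1 _
            exact (mul_le_mul_of_nonneg_left (le_abs_self _) h2).trans
              (mul_le_mul_of_nonneg_right h1 (abs_nonneg _))
      _ = s ^ m * ∑ k ∈ Finset.range (d + 1), |P.coeff k| := by rw [Finset.mul_sum]
      _ ≤ s ^ m * (6 ^ d * (M + ε)) := by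
          gcongr
          exact pow_nonneg hs.1 _
  rw [hsplit]
  exact add_le_add ((le_abs_self _).trans (hlow' s hs)) hPs

end Chebyshev

/-! ### Spectral norms, coordinate projections and trace moments. -/

section Norms

open Matrix

variable {α β : Type*} [Fintype α] [Fintype β] [DecidableEq α] [DecidableEq β]

theorem norm_one_le : ‖(1 : Matrix α α ℂ)‖ ≤ 1 := by
  rw [← diagonal_one, l2_opNorm_diagonal]
  exact (pi_norm_le_iff_of_nonneg zero_le_one).2 fun i => by simp

theorem norm_pow_le_one {A : Matrix α α ℂ} (hA : ‖A‖ ≤ 1) (m : ℕ) : ‖A ^ m‖ ≤ 1 := by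
  rcases m with _ | m
  · simpa using norm_one_le
  · exact (norm_pow_le' A m.succ_pos).trans (pow_le_one₀ (norm_nonneg _) hA)

theorem norm_entry_le (A : Matrix α α ℂ) (i j : α) : ‖A i j‖ ≤ ‖A‖ := by
  have h := l2_opNorm_mulVec A (EuclideanSpace.single j 1)
  have h2 := (PiLp.norm_apply_le
    (WithLp.toLp 2 (A *ᵥ (EuclideanSpace.single j (1 : ℂ)).ofLp)) i).trans h
  simpa using h2

theorem norm_trace_le (A : Matrix α α ℂ) : ‖A.trace‖ ≤ Fintype.card α * ‖A‖ := by
  refine (norm_sum_le _ _).trans ?_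
  refine (Finset.sum_le_card_nsmul _ _ ‖A‖ fun i _ => norm_entry_le A i i).trans ?_
  simp

theorem norm_sq_le_sum_entries (A : Matrix α α ℂ) : ‖A‖ ^ 2 ≤ ∑ i, ∑ j, ‖A i j‖ ^ 2 := by
  have h0 : 0 ≤ ∑ i, ∑ j, ‖A i j‖ ^ 2 := by positivity
  suffices h : ‖A‖ ≤ √(∑ i, ∑ j, ‖A i j‖ ^ 2) from
    (pow_le_pow_left₀ (norm_nonneg _) h 2).trans_eq (Real.sq_sqrt h0)
  rw [cstar_norm_def]
  refine ContinuousLinearMap.opNorm_le_bound _ (Real.sqrt_nonneg _) fun x => ?_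
  refine le_of_sq_le_sq ?_ (by positivity)
  rw [mul_pow, Real.sq_sqrt h0, EuclideanSpace.norm_sq_eq, EuclideanSpace.norm_sq_eq,
    Finset.sum_mul]
  refine Finset.sum_le_sum fun i _ => ?_
  rw [ofLp_toEuclideanCLM]
  calc ‖(A *ᵥ x.ofLp) i‖ ^ 2 ≤ (∑ j, ‖A i j‖ * ‖x.ofLp j‖) ^ 2 := by
        gcongr
        refine (norm_sum_le _ _).trans (le_of_eq ?_)
        simp
    _ ≤ _ := Finset.sum_mul_sq_le_sq_mul_sq _ _ _

/-- The C*-identity gives equality for the exponent `2 ^ m`; splitting off `m` of the factors and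
cancelling the rest gives the exponent `m`. -/
theorem norm_pow_le_norm_pow_of_isSelfAdjoint {S : Matrix α α ℂ} (hS : IsSelfAdjoint S) {m : ℕ}
    (hm : 0 < m) : ‖S‖ ^ m ≤ ‖S ^ m‖ := by
  rcases eq_or_lt_of_le (norm_nonneg S) with h0 | h0
  · rw [← h0, zero_pow hm.ne']
    exact norm_nonneg _
  have hlt : m < 2 ^ m := Nat.lt_two_pow_self
  have h := hS.norm_pow_two_pow m
  have h2 : ‖S‖ ^ (2 ^ m) ≤ ‖S ^ m‖ * ‖S‖ ^ (2 ^ m - m) := by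
    rw [← h]
    conv_lhs => rw [show 2 ^ m = m + (2 ^ m - m) by omega, pow_add]
    exact (norm_mul_le _ _).trans (by gcongr; exact norm_pow_le' _ (Nat.sub_pos_of_lt hlt))
  rw [show ‖S‖ ^ (2 ^ m) = ‖S‖ ^ m * ‖S‖ ^ (2 ^ m - m) by rw [← pow_add]; congr 1; omega] at h2
  exact le_of_mul_le_mul_right h2 (by positivity)

/-- The trace of an even power is the squared Frobenius norm of the half power. -/
theorem norm_pow_le_trace {S : Matrix α α ℂ} (hS : S.IsHermitian) {m : ℕ} (hm : 0 < m) :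
    ‖S‖ ^ (2 * m) ≤ (S ^ (2 * m)).trace.re := by
  have hB : (S ^ m).IsHermitian := hS.pow m
  calc ‖S‖ ^ (2 * m) = (‖S‖ ^ m) ^ 2 := by rw [mul_comm, pow_mul]
    _ ≤ ‖S ^ m‖ ^ 2 := by
        gcongr
        exact norm_pow_le_norm_pow_of_isSelfAdjoint hS hm
    _ ≤ ∑ i, ∑ j, ‖(S ^ m) i j‖ ^ 2 := norm_sq_le_sum_entries _
    _ = (S ^ (2 * m)).trace.re := by
        have h : S ^ (2 * m) = S ^ m * (S ^ m)ᴴ := by rw [hB.eq, ← pow_add, two_mul]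
        rw [h]
        simp only [trace, diag, mul_apply, conjTranspose_apply, Complex.re_sum]
        refine Finset.sum_congr rfl fun i _ => Finset.sum_congr rfl fun j _ => ?_
        rw [← Complex.normSq_eq_norm_sq]
        simp [Complex.normSq_apply]

/-- The coordinate projection onto `S`. -/
noncomputable def proj (S : Finset α) : Matrix α α ℂ := diagonal fun i => if i ∈ S then 1 else 0

theorem proj_mul_self (S : Finset α) : proj S * proj S = proj S := by
  simp [proj, diagonal_mul_diagonal]

theorem proj_conjTranspose {γ : Type*} [DecidableEq γ] (S : Finset γ) : (proj S)ᴴ = proj S := by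
  rw [proj, diagonal_conjTranspose]
  congr 1
  ext i
  by_cases h : i ∈ S <;> simp [h]

theorem norm_proj_le (S : Finset α) : ‖proj S‖ ≤ 1 := by
  rw [proj, l2_opNorm_diagonal]
  refine (pi_norm_le_iff_of_nonneg zero_le_one).2 fun i => ?_
  by_cases h : i ∈ S <;> simp [h]

/-- Matrix selecting the coordinates in `S`. -/
noncomputable def selection (S : Finset α) : Matrix S α ℂ :=
  of fun i j => if j = i then 1 else 0

theorem selection_mul_apply (S : Finset α) {γ : Type*} (B : Matrix α γ ℂ) (i : S) (j : γ) :
    (selection S * B) i j = B i j := by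
  simp [selection, mul_apply]

theorem mul_selection_conjTranspose_apply (S : Finset α) {γ : Type*} (B : Matrix γ α ℂ) (i : γ)
    (j : S) : (B * (selection S)ᴴ) i j = B i j := by
  simp [selection, mul_apply, apply_ite (star : ℂ → ℂ)]

theorem norm_selection_conjTranspose_le (S : Finset α) : ‖(selection S)ᴴ‖ ≤ 1 := by
  have h := l2_opNorm_conjTranspose_mul_self (selection S)ᴴ
  have h1 : selection S * (selection S)ᴴ = 1 := by
    ext i j
    rw [mul_selection_conjTranspose_apply, selection, of_apply, one_apply]
    simp only [Subtype.ext_iff, eq_comm]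
  rw [conjTranspose_conjTranspose, h1] at h
  have h2 : ‖(1 : Matrix S S ℂ)‖ ≤ 1 := norm_one_le
  nlinarith [norm_nonneg (selection S)ᴴ]

theorem norm_selection_le (S : Finset α) : ‖selection S‖ ≤ 1 := by
  rw [← l2_opNorm_conjTranspose]
  exact norm_selection_conjTranspose_le S

theorem norm_restrict_le {n : ℕ} (A : Matrix (Fin n) (Fin n) ℂ) (Ω T : Finset (Fin n)) :
    ‖restrict A Ω T‖ ≤ ‖proj Ω * A * proj T‖ := by
  have h : restrict A Ω T = selection Ω * (proj Ω * A * proj T) * (selection T)ᴴ := by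
    ext i j
    rw [mul_selection_conjTranspose_apply, selection_mul_apply, proj, proj, mul_diagonal,
      diagonal_mul]
    simp [restrict]
  rw [h]
  calc _ ≤ ‖selection Ω‖ * ‖proj Ω * A * proj T‖ * ‖(selection T)ᴴ‖ :=
        (l2_opNorm_mul _ _).trans (by gcongr; exact l2_opNorm_mul _ _)
    _ ≤ 1 * ‖proj Ω * A * proj T‖ * 1 := by
        gcongr
        · exact norm_selection_le Ω
        · exact norm_selection_conjTranspose_le T
    _ = _ := by ring

/-- The real part of the trace of the `p`-th power of `A_{ΩT} A_{ΩT}^*`. -/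
noncomputable def traceMoment (A : Matrix α α ℂ) (p : ℕ) (Ω T : Finset α) : ℝ :=
  ((proj Ω * A * proj T * Aᴴ) ^ p).trace.re

/-- Inner projections merge by idempotence, so only the last one survives; cyclicity of the trace
later absorbs it. -/
theorem gram_pow (A : Matrix α α ℂ) (Ω T : Finset α) (p : ℕ) :
    ((proj Ω * A * proj T) * (proj Ω * A * proj T)ᴴ) ^ (p + 1) =
      (proj Ω * A * proj T * Aᴴ) ^ (p + 1) * proj Ω := by
  have h1 : (proj Ω * A * proj T) * (proj Ω * A * proj T)ᴴ =
      proj Ω * A * proj T * Aᴴ * proj Ω := by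
    simp only [conjTranspose_mul, proj_conjTranspose, Matrix.mul_assoc]
    rw [← Matrix.mul_assoc (proj T) (proj T), proj_mul_self]
  have h2 : proj Ω * (proj Ω * A * proj T * Aᴴ) = proj Ω * A * proj T * Aᴴ := by
    simp only [← Matrix.mul_assoc, proj_mul_self]
  rw [h1]
  set N := proj Ω * A * proj T * Aᴴ
  induction p with
  | zero => simp
  | succ p ih =>
    rw [pow_succ, ih, pow_succ _ (p + 1)]
    calc N ^ (p + 1) * proj Ω * (N * proj Ω) = N ^ (p + 1) * (proj Ω * N) * proj Ω := by
          simp only [Matrix.mul_assoc]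
      _ = _ := by rw [h2]

theorem norm_pow_le_traceMoment (A : Matrix α α ℂ) (Ω T : Finset α) {m : ℕ} (hm : 0 < m) :
    ‖proj Ω * A * proj T‖ ^ (2 * (2 * m)) ≤ traceMoment A (2 * m) Ω T := by
  set B := proj Ω * A * proj T with hB
  have h1 : ‖B * Bᴴ‖ = ‖B‖ ^ 2 := by
    rw [sq]
    exact CStarRing.norm_self_mul_star
  rw [pow_mul, ← h1]
  refine (norm_pow_le_trace (isHermitian_mul_conjTranspose_self B) hm).trans (le_of_eq ?_)
  obtain ⟨k, hk⟩ : ∃ k, 2 * m = k + 1 := ⟨2 * m - 1, by omega⟩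
  rw [traceMoment, hk, hB, gram_pow, trace_mul_comm, pow_succ', ← Matrix.mul_assoc]
  simp only [← Matrix.mul_assoc, proj_mul_self]

/-- A power of a product of contractions is a contraction. This deterministic bound holds at every
selector rate and feeds the extrapolation. -/
theorem abs_traceMoment_le {A : Matrix α α ℂ} (hA : ‖A‖ ≤ 1) (p : ℕ) (Ω T : Finset α) :
    |traceMoment A p Ω T| ≤ Fintype.card α := by
  have h : ‖proj Ω * A * proj T * Aᴴ‖ ≤ 1 := by
    calc _ ≤ ‖proj Ω‖ * ‖A‖ * ‖proj T‖ * ‖Aᴴ‖ := by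
          refine (norm_mul_le _ _).trans ?_
          gcongr
          refine (norm_mul_le _ _).trans ?_
          gcongr
          exact norm_mul_le _ _
      _ ≤ 1 * 1 * 1 * 1 := by
          gcongr
          · exact norm_proj_le Ω
          · exact norm_proj_le T
          · rwa [l2_opNorm_conjTranspose]
      _ = 1 := by norm_num
  refine (Complex.abs_re_le_norm _).trans ((norm_trace_le _).trans ?_)
  exact mul_le_of_le_one_right (by positivity) (norm_pow_le_one h p)

end Norms

/-! ### The Fourier matrix is unitary with flat entries. -/

section Fourier

open Matrix Complex

theorem fourierVec_eq (n : ℕ) (j t : Fin n) :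
    fourierVec n j t = ((Real.sqrt n : ℝ) : ℂ)⁻¹ *
      (exp (2 * Real.pi * I / n) ^ ((j : ℕ) + 1)) ^ ((t : ℕ) + 1) := by
  rw [fourierVec, one_div, ← pow_mul, ← Complex.exp_nat_mul]
  congr 2
  push_cast
  ring

theorem norm_dftMatrix_apply (n : ℕ) (i j : Fin n) :
    ‖dftMatrix n i j‖ = (n : ℝ) ^ (-(1 / 2) : ℝ) := by
  have hn : n ≠ 0 := (i.pos).ne'
  have h1 : ‖exp (2 * Real.pi * I / n)‖ = 1 :=
    (Complex.isPrimitiveRoot_exp n hn).norm'_eq_one hn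
  rw [dftMatrix, of_apply, norm_star, fourierVec_eq, norm_mul, norm_pow, norm_pow, h1, norm_inv,
    Complex.norm_real, Real.norm_of_nonneg (Real.sqrt_nonneg _), one_pow, one_pow, mul_one,
    Real.sqrt_eq_rpow, Real.rpow_neg (Nat.cast_nonneg n)]

theorem dftMatrix_mul_conjTranspose (n : ℕ) : dftMatrix n * (dftMatrix n)ᴴ = 1 := by
  ext i j
  have hn : n ≠ 0 := (i.pos).ne'
  have hprim := Complex.isPrimitiveRoot_exp n hn
  set ζ := exp (2 * Real.pi * I / n) with hζ
  have hnorm : ‖ζ‖ = 1 := hprim.norm'_eq_one hn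
  have hζ0 : ζ ≠ 0 := by
    intro h
    simp [h] at hnorm
  have hstar : star ζ = ζ⁻¹ := (Complex.inv_eq_conj hnorm).symm
  have hsq : (((Real.sqrt n : ℝ) : ℂ))⁻¹ * ((Real.sqrt n : ℝ) : ℂ)⁻¹ = (n : ℂ)⁻¹ := by
    rw [← mul_inv, ← Complex.ofReal_mul, Real.mul_self_sqrt (Nat.cast_nonneg n)]
    simp
  -- `w = ζ^(j-i)`, and the inner product of rows `i` and `j` is a geometric sum in `w`; indexing
  -- from 1 produces the extra factor `w`.
  set w := (ζ⁻¹) ^ ((i : ℕ) + 1) * ζ ^ ((j : ℕ) + 1) with hw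
  have hentry : (dftMatrix n * (dftMatrix n)ᴴ) i j =
      (n : ℂ)⁻¹ * (w * ∑ t ∈ Finset.range n, w ^ t) := by
    rw [mul_apply, Finset.mul_sum, Finset.mul_sum, ← Fin.sum_univ_eq_sum_range
      (fun t => (n : ℂ)⁻¹ * (w * w ^ t))]
    refine Finset.sum_congr rfl fun t _ => ?_
    rw [conjTranspose_apply, dftMatrix, of_apply, of_apply, star_star, fourierVec_eq, fourierVec_eq,
      ← hζ, star_mul', star_pow, star_pow, hstar, star_inv₀, ← hsq, ← pow_succ', hw, mul_pow]
    simp only [Complex.star_def, Complex.conj_ofReal]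
    ring
  rw [hentry, one_apply]
  split_ifs with h
  · have hw1 : w = 1 := by rw [hw, h, ← mul_pow, inv_mul_cancel₀ hζ0, one_pow]
    rw [hw1]
    simp [hn]
  · have hw1 : w ≠ 1 := by
      intro h1
      have h2 : ζ ^ ((j : ℕ) + 1) = ζ ^ ((i : ℕ) + 1) := by
        rw [hw, inv_pow] at h1
        exact ((inv_mul_eq_one₀ (pow_ne_zero _ hζ0)).1 h1).symm
      rw [pow_succ, pow_succ] at h2
      exact h (Fin.ext (hprim.pow_inj i.2 j.2 (mul_right_cancel₀ hζ0 h2).symm))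
    have hwn : w ^ n = 1 := by
      rw [hw, mul_pow, ← pow_mul, ← pow_mul, mul_comm _ n, mul_comm _ n, pow_mul, pow_mul, inv_pow,
        hprim.pow_eq_one]
      simp
    have h3 := mul_geom_sum w n
    rw [hwn, sub_self] at h3
    rw [(mul_eq_zero.1 h3).resolve_left (sub_ne_zero.2 hw1), mul_zero, mul_zero]

theorem norm_dftMatrix_le (n : ℕ) : ‖dftMatrix n‖ ≤ 1 := by
  have h : ‖dftMatrix n * (dftMatrix n)ᴴ‖ = ‖dftMatrix n‖ * ‖dftMatrix n‖ :=
    CStarRing.norm_self_mul_star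
  rw [dftMatrix_mul_conjTranspose] at h
  have h2 : ‖(1 : Matrix (Fin n) (Fin n) ℂ)‖ ≤ 1 := norm_one_le
  nlinarith [norm_nonneg (dftMatrix n)]

end Fourier

/-! ### Expansion of trace moments over walks, and counting of walks. -/

section Walks

open Matrix

variable {α : Type*} [Fintype α] [DecidableEq α]

/-- The set of values of a tuple. -/
def tupleRange {γ : Type*} [DecidableEq γ] {p : ℕ} (i : Fin p → γ) : Finset γ := Finset.univ.image i

theorem tupleRange_cons {γ : Type*} [DecidableEq γ] {p : ℕ} (a : γ) (i : Fin p → γ) :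
    tupleRange (Fin.cons a i : Fin (p + 1) → γ) = insert a (tupleRange i) := by
  ext x
  simp [tupleRange, Fin.exists_fin_succ, eq_comm]

theorem card_tupleRange_le {γ : Type*} [DecidableEq γ] {p : ℕ} (i : Fin p → γ) :
    (tupleRange i).card ≤ p :=
  Finset.card_image_le.trans (by simp)

theorem sum_tuple_succ {γ R : Type*} [Fintype γ] [AddCommMonoid R] {p : ℕ}
    (f : (Fin (p + 1) → γ) → R) : ∑ i, f i = ∑ a : γ, ∑ i : Fin p → γ, f (Fin.cons a i) := by
  rw [← (Fin.consEquiv fun _ => γ).sum_comp, Fintype.sum_prod_type]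
  rfl

/-- Counting tuples by the number of distinct entries, through a generating function. -/
theorem sum_pow_card_tupleRange_le {y : ℝ} (hy : 0 ≤ y) (p : ℕ) :
    ∑ i : Fin p → α, y ^ (tupleRange i).card ≤ (p + Fintype.card α * y) ^ p := by
  induction p with
  | zero => simp [tupleRange]
  | succ p ih =>
    rw [sum_tuple_succ, Finset.sum_comm]
    -- A new entry either repeats one of at most `p` values, at no cost, or is paid for by a factor
    -- `y`.
    have hstep : ∀ i : Fin p → α, ∑ a : α, y ^ (tupleRange (Fin.cons a i : Fin (p + 1) → α)).card ≤
        y ^ (tupleRange i).card * (p + Fintype.card α * y) := by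
      intro i
      have hterm : ∀ a : α, y ^ (tupleRange (Fin.cons a i : Fin (p + 1) → α)).card ≤
          (if a ∈ tupleRange i then y ^ (tupleRange i).card else 0) +
            y ^ (tupleRange i).card * y := by
        intro a
        rw [tupleRange_cons]
        split_ifs with h
        · rw [Finset.insert_eq_of_mem h]
          exact le_add_of_nonneg_right (by positivity)
        · rw [Finset.card_insert_of_notMem h, pow_succ, zero_add]
      refine (Finset.sum_le_sum fun a _ => hterm a).trans ?_
      rw [Finset.sum_add_distrib, Finset.sum_ite_mem, Finset.univ_inter, Finset.sum_const,
        Finset.sum_const, nsmul_eq_mul, nsmul_eq_mul, Finset.card_univ]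
      have h1 : ((tupleRange i).card : ℝ) ≤ p := by exact_mod_cast card_tupleRange_le i
      have h2 : 0 ≤ y ^ (tupleRange i).card := by positivity
      nlinarith
    calc _ ≤ ∑ i : Fin p → α, y ^ (tupleRange i).card * (p + Fintype.card α * y) :=
          Finset.sum_le_sum fun i _ => hstep i
      _ ≤ (p + Fintype.card α * y) ^ p * (p + Fintype.card α * y) := by
          rw [← Finset.sum_mul]
          gcongr
      _ ≤ _ := by
          rw [← pow_succ]
          push_cast
          gcongr
          simp

/-- The indicator of `I ⊆ S`. -/
def subsetInd {γ : Type*} [DecidableEq γ] (I S : Finset γ) : ℝ := if I ⊆ S then 1 else 0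

theorem subsetInd_insert {γ : Type*} [DecidableEq γ] (a : γ) (I S : Finset γ) :
    subsetInd (insert a I) S = (if a ∈ S then 1 else 0) * subsetInd I S := by
  simp only [subsetInd, Finset.insert_subset_iff]
  by_cases h1 : a ∈ S <;> by_cases h2 : I ⊆ S <;> simp [h1, h2]

theorem gram_apply (A : Matrix α α ℂ) (Ω T : Finset α) (z y : α) :
    (proj Ω * A * proj T * Aᴴ) z y =
      ∑ t, A z t * star (A y t) *
        ((if z ∈ Ω then 1 else 0 : ℝ) * (if t ∈ T then 1 else 0 : ℝ) : ℝ) := by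
  rw [mul_apply]
  refine Finset.sum_congr rfl fun t _ => ?_
  rw [proj, proj, mul_diagonal, diagonal_mul, conjTranspose_apply]
  by_cases h1 : z ∈ Ω <;> by_cases h2 : t ∈ T <;> simp [h1, h2]

/-- Expansion of the entries of a power of `D_Ω A D_T A^*` as a sum over walks. -/
theorem exists_walk_expansion (A : Matrix α α ℂ) {b : ℝ} (hb : ∀ i j, ‖A i j‖ ≤ b) (p : ℕ) :
    ∃ w : (Fin p → α) → (Fin p → α) → α → α → ℂ,
      (∀ i j x y, ‖w i j x y‖ ≤ (b ^ 2) ^ p) ∧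
      ∀ Ω T x y, ((proj Ω * A * proj T * Aᴴ) ^ p) x y =
        ∑ i, ∑ j, w i j x y *
          ((subsetInd (tupleRange i) Ω * subsetInd (tupleRange j) T : ℝ) : ℂ) := by
  induction p with
  | zero =>
    refine ⟨fun _ _ x y => (1 : Matrix α α ℂ) x y, fun _ _ x y => ?_, fun Ω T x y => ?_⟩
    · by_cases h : x = y
      · subst h
        simp
      · simp [h]
    · simp [tupleRange, subsetInd]
  | succ p ih =>
    obtain ⟨w, hw, hexp⟩ := ih
    -- Tuples run backwards along the walk: `pow_succ` adds a factor on the right, so the head is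
    -- the last row before `y`.
    refine ⟨fun i j x y => w (Fin.tail i) (Fin.tail j) x (i 0) * (A (i 0) (j 0) * star (A y (j 0))),
      fun i j x y => ?_, fun Ω T x y => ?_⟩
    · rw [norm_mul, norm_mul, norm_star, pow_succ]
      have hb0 : 0 ≤ b := (norm_nonneg _).trans (hb x x)
      have h1 := hb (i 0) (j 0)
      have h2 := hb y (j 0)
      rw [sq b]
      have h3 := hw (Fin.tail i) (Fin.tail j) x (i 0)
      rw [sq b] at h3
      gcongr
    · rw [pow_succ, mul_apply, sum_tuple_succ]
      refine Finset.sum_congr rfl fun z _ => ?_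
      simp only [sum_tuple_succ (γ := α), Fin.tail_cons, Fin.cons_zero, tupleRange_cons,
        subsetInd_insert]
      rw [hexp, gram_apply, Finset.sum_mul]
      refine Finset.sum_congr rfl fun i _ => ?_
      rw [Finset.sum_mul_sum, Finset.sum_comm]
      refine Finset.sum_congr rfl fun t _ => Finset.sum_congr rfl fun j _ => ?_
      push_cast
      ring

/-- The trace moment is a combination of products of inclusion indicators with small weights. -/
theorem exists_traceMoment_expansion (A : Matrix α α ℂ) {b : ℝ} (hb : ∀ i j, ‖A i j‖ ≤ b) (p : ℕ) :
    ∃ c : (Fin p → α) → (Fin p → α) → ℝ,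
      (∀ i j, |c i j| ≤ Fintype.card α * (b ^ 2) ^ p) ∧
      ∀ Ω T, traceMoment A p Ω T =
        ∑ i, ∑ j, c i j * (subsetInd (tupleRange i) Ω * subsetInd (tupleRange j) T) := by
  obtain ⟨w, hw, hexp⟩ := exists_walk_expansion A hb p
  refine ⟨fun i j => ∑ x, (w i j x x).re, fun i j => ?_, fun Ω T => ?_⟩
  · refine (Finset.abs_sum_le_sum_abs _ _).trans ?_
    refine (Finset.sum_le_card_nsmul _ _ ((b ^ 2) ^ p) fun x _ => ?_).trans ?_
    · exact (Complex.abs_re_le_norm _).trans (hw i j x x)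
    · simp
  · rw [traceMoment, trace, Complex.re_sum]
    simp only [diag, hexp, Complex.re_sum, Complex.re_mul_ofReal]
    rw [Finset.sum_comm]
    refine Finset.sum_congr rfl fun i _ => ?_
    rw [Finset.sum_comm]
    refine Finset.sum_congr rfl fun j _ => ?_
    rw [Finset.sum_mul]

end Walks

/-! ### Means over independent selectors. -/

section Selectors

variable {α : Type*} [Fintype α] [DecidableEq α]

/-- The probability that independent selectors with rate `s` pick exactly the set `S`. -/
def selectorWeight {γ : Type*} [Fintype γ] (s : ℝ) (S : Finset γ) : ℝ :=
  s ^ S.card * (1 - s) ^ (Fintype.card γ - S.card)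

theorem selectorWeight_nonneg {γ : Type*} [Fintype γ] {s : ℝ} (hs : s ∈ Set.Icc (0 : ℝ) 1)
    (S : Finset γ) :
    0 ≤ selectorWeight s S :=
  mul_nonneg (pow_nonneg hs.1 _) (pow_nonneg (by linarith [hs.2]) _)

/-- Expand a product of sums `s + (1 - s)` over subsets, with `1 - s` replaced by 0 on `I`: exactly
the sets containing `I` survive. This is what makes mean moments polynomial in the rate. -/
theorem sum_selectorWeight_mul_subsetInd (s : ℝ) (I : Finset α) :
    ∑ S, selectorWeight s S * subsetInd I S = s ^ I.card := by
  have h := Finset.prod_add (fun _ : α => s) (fun x => if x ∈ I then 0 else 1 - s) Finset.univ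
  have hl : ∏ x : α, (s + if x ∈ I then 0 else 1 - s) = s ^ I.card := by
    rw [← Finset.prod_const, ← Finset.prod_subset (Finset.subset_univ I)]
    · exact Finset.prod_congr rfl fun x hx => by simp [hx]
    · intro x _ hx
      simp [hx]
  rw [← hl, h, Finset.powerset_univ]
  refine Finset.sum_congr rfl fun S _ => ?_
  rw [Finset.prod_const, selectorWeight, subsetInd, mul_assoc]
  congr 1
  split_ifs with hIS
  · rw [mul_one, ← Finset.card_univ, ← Finset.card_sdiff_of_subset (Finset.subset_univ S),
      ← Finset.prod_const]
    refine Finset.prod_congr rfl fun x hx => ?_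
    rw [if_neg fun hxI => (Finset.mem_sdiff.1 hx).2 (hIS hxI)]
  · obtain ⟨x, hxI, hxS⟩ := Finset.not_subset.1 hIS
    rw [mul_zero, Finset.prod_eq_zero (i := x) (by simp [hxS]) (by simp [hxI])]

theorem sum_selectorWeight (s : ℝ) : ∑ S : Finset α, selectorWeight s S = 1 := by
  simpa [subsetInd] using sum_selectorWeight_mul_subsetInd s (∅ : Finset α)

/-- Expectation over two independent families of selectors. -/
def selectorMean (s t : ℝ) (f : Finset α → Finset α → ℝ) : ℝ :=
  ∑ Ω, ∑ T, selectorWeight s Ω * selectorWeight t T * f Ω T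

theorem abs_selectorMean_le {s t M : ℝ} (hs : s ∈ Set.Icc (0 : ℝ) 1) (ht : t ∈ Set.Icc (0 : ℝ) 1)
    {f : Finset α → Finset α → ℝ} (hf : ∀ Ω T, |f Ω T| ≤ M) : |selectorMean s t f| ≤ M := by
  calc |selectorMean s t f| ≤ ∑ Ω, ∑ T, selectorWeight s Ω * selectorWeight t T * M := by
        refine (Finset.abs_sum_le_sum_abs _ _).trans (Finset.sum_le_sum fun Ω _ => ?_)
        refine (Finset.abs_sum_le_sum_abs _ _).trans (Finset.sum_le_sum fun T _ => ?_)
        have h0 := mul_nonneg (selectorWeight_nonneg hs Ω) (selectorWeight_nonneg ht T)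
        rw [abs_mul, abs_of_nonneg h0]
        exact mul_le_mul_of_nonneg_left (hf Ω T) h0
    _ = M := by
        simp only [← Finset.sum_mul, ← Finset.mul_sum, sum_selectorWeight, one_mul]

theorem selectorMean_subsetInd {ι : Type*} [Fintype ι] (s t : ℝ) (c : ι → ι → ℝ)
    (r : ι → Finset α) :
    selectorMean s t (fun Ω T => ∑ i, ∑ j, c i j * (subsetInd (r i) Ω * subsetInd (r j) T)) =
      ∑ i, ∑ j, c i j * (s ^ (r i).card * t ^ (r j).card) := by
  simp only [selectorMean, Finset.mul_sum]
  simp_rw [← sum_selectorWeight_mul_subsetInd, Finset.sum_mul_sum, Finset.mul_sum]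
  have h1 : ∀ f : Finset α → Finset α → ι → ι → ℝ,
      ∑ Ω, ∑ T, ∑ i, ∑ j, f Ω T i j = ∑ i, ∑ j, ∑ Ω, ∑ T, f Ω T i j := by
    intro f
    calc _ = ∑ q : Finset α × Finset α, ∑ u : ι × ι, f q.1 q.2 u.1 u.2 := by
          simp only [Fintype.sum_prod_type]
      _ = ∑ u : ι × ι, ∑ q : Finset α × Finset α, f q.1 q.2 u.1 u.2 := Finset.sum_comm
      _ = _ := by simp only [Fintype.sum_prod_type]
  rw [h1]
  refine Finset.sum_congr rfl fun i _ => Finset.sum_congr rfl fun j _ =>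
    Finset.sum_congr rfl fun Ω _ => Finset.sum_congr rfl fun T _ => ?_
  ring

open Matrix in
/-- Bound for the mean trace moment of a random submatrix, without logarithmic loss. -/
theorem selectorMean_traceMoment_le {n : ℕ} (hn : 0 < n) {A : Matrix (Fin n) (Fin n) ℂ}
    (hA : ‖A‖ ≤ 1) (hb : ∀ i j, ‖A i j‖ ≤ (n : ℝ) ^ (-(1 / 2) : ℝ)) {p q : ℕ} (hqp : q ≤ p)
    {s θ : ℝ} (hs : s ∈ Set.Icc (0 : ℝ) 1) (hθ : θ ∈ Set.Icc (0 : ℝ) 1) {ε : ℝ}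
    (hε : ε = n * ((p + 1) ^ (2 * p) / n ^ q)) :
    selectorMean s (θ * s) (traceMoment A p) ≤
      ε + s ^ (p - q) * (6 ^ (2 * p) * (n + ε)) := by
  have hn' : (0 : ℝ) < n := Nat.cast_pos.2 hn
  obtain ⟨c, hc, hexp⟩ := exists_traceMoment_expansion A hb p
  have hsq : ((n : ℝ) ^ (-(1 / 2) : ℝ)) ^ 2 = (n : ℝ)⁻¹ := by
    rw [← Real.rpow_natCast, ← Real.rpow_mul hn'.le, ← Real.rpow_neg_one]
    norm_num
  -- Tying the second rate to the first by `θ` leaves a polynomial in one variable.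
  have hmean : ∀ x : ℝ, selectorMean x (θ * x) (traceMoment A p) =
      ∑ u : (Fin p → Fin n) × (Fin p → Fin n), (c u.1 u.2 * θ ^ (tupleRange u.2).card) *
        x ^ ((tupleRange u.1).card + (tupleRange u.2).card) := by
    intro x
    rw [show traceMoment A p = fun Ω T => _ from funext fun Ω => funext fun T => hexp Ω T,
      selectorMean_subsetInd, Fintype.sum_prod_type]
    refine Finset.sum_congr rfl fun i _ => Finset.sum_congr rfl fun j _ => ?_
    ring
  rw [hmean]
  refine sum_mul_pow_le_of_bounded _ _ (fun u => ?_) hn' ?_ (fun x hx => ?_) hs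
  · have h1 := card_tupleRange_le u.1
    have h2 := card_tupleRange_le u.2
    omega
  · have hcount : ∑ u : (Fin p → Fin n) × (Fin p → Fin n),
        ((n : ℝ)⁻¹) ^ ((tupleRange u.1).card + (tupleRange u.2).card) ≤ (p + 1) ^ (2 * p) := by
      have h1 := sum_pow_card_tupleRange_le (α := Fin n) (y := (n : ℝ)⁻¹) (by positivity) p
      rw [Fintype.card_fin, mul_inv_cancel₀ hn'.ne'] at h1
      rw [Fintype.sum_prod_type]
      simp only [pow_add, ← Finset.mul_sum, ← Finset.sum_mul]
      rw [two_mul, pow_add]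
      gcongr
    -- In degree `e < p - q` the factor `n^{-p}` is at most `n^{-q} n^{-e}`; the sum of `n^{-e}`
    -- over all pairs is `hcount`.
    have hterm : ∀ u : (Fin p → Fin n) × (Fin p → Fin n),
        (tupleRange u.1).card + (tupleRange u.2).card < p - q →
        |c u.1 u.2 * θ ^ (tupleRange u.2).card| ≤
          n * (1 / n ^ q) * ((n : ℝ)⁻¹) ^ ((tupleRange u.1).card + (tupleRange u.2).card) := by
      intro u hu
      rw [abs_mul, abs_of_nonneg (pow_nonneg hθ.1 _)]
      refine (mul_le_of_le_one_right (abs_nonneg _) (pow_le_one₀ hθ.1 hθ.2)).trans ?_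
      refine (hc u.1 u.2).trans ?_
      rw [hsq, Fintype.card_fin, mul_assoc, one_div, ← inv_pow, ← pow_add]
      refine mul_le_mul_of_nonneg_left ?_ hn'.le
      exact pow_le_pow_of_le_one (by positivity)
        (inv_le_one_of_one_le₀ (by exact_mod_cast hn)) (by omega)
    calc _ ≤ ∑ u : (Fin p → Fin n) × (Fin p → Fin n) with
          (tupleRange u.1).card + (tupleRange u.2).card < p - q,
          n * (1 / n ^ q) * ((n : ℝ)⁻¹) ^ ((tupleRange u.1).card + (tupleRange u.2).card) :=
          Finset.sum_le_sum fun u hu => hterm u (Finset.mem_filter.1 hu).2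
      _ ≤ ∑ u : (Fin p → Fin n) × (Fin p → Fin n),
          n * (1 / n ^ q) * ((n : ℝ)⁻¹) ^ ((tupleRange u.1).card + (tupleRange u.2).card) :=
          Finset.sum_le_sum_of_subset_of_nonneg (Finset.filter_subset _ _)
            fun u _ _ => by positivity
      _ ≤ n * (1 / n ^ q) * (p + 1) ^ (2 * p) := by
          rw [← Finset.mul_sum]
          gcongr
      _ = ε := by rw [hε]; ring
  · rw [← hmean]
    have hθx : θ * x ∈ Set.Icc (0 : ℝ) 1 :=
      ⟨mul_nonneg hθ.1 hx.1, mul_le_one₀ hθ.2 hx.1 hx.2⟩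
    exact abs_selectorMean_le hx hθx fun Ω T => by simpa using abs_traceMoment_le hA p Ω T

end Selectors

/-! ### From uniform sets of fixed size to selectors. -/

section Uniform

open MeasureTheory ProbabilityTheory

/-- The mean `k` of the binomial law with parameters `n` and `k / n` is its mode, so its weight
is at least `1 / (n + 1)`. -/
theorem one_le_mul_binomial_mean {n k : ℕ} (hkn : k < n) {s : ℝ} (hs : s * n = k) :
    1 ≤ (n + 1) * (n.choose k * (s ^ k * (1 - s) ^ (n - k))) := by
  have hn : (0 : ℝ) < n := Nat.cast_pos.2 (by omega)
  have hkn' : (k : ℝ) + 1 ≤ n := by exact_mod_cast hkn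
  have hs0 : 0 ≤ s := by
    by_contra h
    have : s * n < 0 := mul_neg_of_neg_of_pos (not_le.1 h) hn
    have := Nat.cast_nonneg (α := ℝ) k
    linarith
  have hs1 : 0 < 1 - s := by
    by_contra h
    nlinarith
  set b : ℕ → ℝ := fun j => n.choose j * (s ^ j * (1 - s) ^ (n - j)) with hb
  have hb0 : ∀ j, 0 ≤ b j := fun j =>
    mul_nonneg (Nat.cast_nonneg _) (mul_nonneg (pow_nonneg hs0 _) (pow_nonneg hs1.le _))
  -- The ratio of consecutive binomial weights shows that they rise up to `k` and fall after it.
  have hratio : ∀ j < n, b (j + 1) * ((j + 1) * (1 - s)) = b j * ((n - j) * s) := by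
    intro j hj
    have h1 : (n.choose (j + 1) : ℝ) * (j + 1) = n.choose j * (n - j) := by
      have := Nat.choose_succ_right_eq n j
      rw [← Nat.cast_sub hj.le]
      exact_mod_cast this
    have h2 : (1 - s) ^ (n - j) = (1 - s) ^ (n - (j + 1)) * (1 - s) := by
      rw [← pow_succ]
      congr 1
      omega
    simp only [hb]
    rw [h2, pow_succ]
    linear_combination (s ^ j * s * (1 - s) ^ (n - (j + 1)) * (1 - s)) * h1
  have hup : ∀ j < k, b j ≤ b (j + 1) := by
    intro j hj
    have hj' : (j : ℝ) + 1 ≤ k := by exact_mod_cast hj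
    have h := hratio j (by omega)
    have hpos : 0 < (j + 1 : ℝ) * (1 - s) := by positivity
    have h1 : (j + 1) * (1 - s) ≤ (n - j) * s := by nlinarith
    have h2 := mul_le_mul_of_nonneg_left h1 (hb0 j)
    rw [← h] at h2
    exact le_of_mul_le_mul_right h2 hpos
  have hdown : ∀ j, k ≤ j → j < n → b (j + 1) ≤ b j := by
    intro j hj hjn
    have hj' : (k : ℝ) ≤ j := by exact_mod_cast hj
    have h := hratio j hjn
    have hpos : 0 < (j + 1 : ℝ) * (1 - s) := by positivity
    have h1 : (n - j) * s ≤ (j + 1) * (1 - s) := by nlinarith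
    have h2 := mul_le_mul_of_nonneg_left h1 (hb0 j)
    rw [← h] at h2
    exact le_of_mul_le_mul_right h2 hpos
  have hle : ∀ j ≤ n, b j ≤ b k := by
    intro j hj
    rcases le_total j k with h | h
    · exact Nat.decreasingInduction' (P := fun i => b i ≤ b k)
        (fun i hi _ ih => (hup i hi).trans ih) h le_rfl
    · induction j, h using Nat.le_induction with
      | base => exact le_rfl
      | succ j hkj ih => exact (hdown j hkj (by omega)).trans (ih (by omega))
  have hsum : ∑ j ∈ Finset.range (n + 1), b j = 1 := by
    have h := add_pow s (1 - s) n
    rw [show s + (1 - s) = 1 by ring, one_pow] at h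
    rw [h]
    exact Finset.sum_congr rfl fun j _ => mul_comm _ _
  have := Finset.sum_le_card_nsmul (Finset.range (n + 1)) b (b k)
    fun j hj => hle j (by simpa [Nat.lt_succ_iff] using hj)
  rw [hsum, Finset.card_range, nsmul_eq_mul] at this
  exact_mod_cast this

theorem randomSet_real_singleton {n k : ℕ} (S : Finset (Fin n)) :
    (randomSet n k).real {S} = if S.card = k then ((n.choose k : ℝ))⁻¹ else 0 := by
  have hset : {S : Finset (Fin n) | S.card = k} =
      ((Finset.univ.powersetCard k : Finset (Finset (Fin n))) : Set (Finset (Fin n))) := by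
    ext S
    simp
  have hm : MeasurableSet {S : Finset (Fin n) | S.card = k} := (Set.toFinite _).measurableSet
  rw [randomSet, uniformOn, Measure.real, cond_apply hm]
  have hc : Measure.count {S : Finset (Fin n) | S.card = k} = n.choose k := by
    rw [hset, Measure.count_apply_finset, Finset.card_powersetCard, Finset.card_univ,
      Fintype.card_fin]
  rw [hc]
  split_ifs with h
  · rw [Set.inter_eq_right.2 (by simpa using h), Measure.count_singleton]
    simp
  · rw [Set.inter_singleton_eq_empty.2 (by simpa using h)]
    simp

/-- The uniform law on `k`-sets is dominated by `n + 1` times the selector law with rate `k / n`. -/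
theorem randomSet_real_singleton_le {n k : ℕ} (hkn : k < n) {s : ℝ} (hs : s * n = k)
    (hs01 : s ∈ Set.Icc (0 : ℝ) 1) (S : Finset (Fin n)) :
    (randomSet n k).real {S} ≤ (n + 1) * selectorWeight s S := by
  rw [randomSet_real_singleton]
  split_ifs with h
  · have hc : (0 : ℝ) < n.choose k := Nat.cast_pos.2 (Nat.choose_pos hkn.le)
    rw [inv_le_iff_one_le_mul₀ hc, selectorWeight, h, Fintype.card_fin]
    refine (one_le_mul_binomial_mean hkn hs).trans (le_of_eq ?_)
    ring
  · exact mul_nonneg (by positivity) (selectorWeight_nonneg hs01 S)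

/-- Markov's inequality combined with pointwise domination. Pairs with `Ω.card ≠ k` have no mass, so
`f` need exceed 1 only on the others. -/
theorem prod_randomSet_real_le {n k l : ℕ} (hkn : k < n) (hln : l < n) {s t : ℝ} (hs : s * n = k)
    (ht : t * n = l) (hs01 : s ∈ Set.Icc (0 : ℝ) 1) (ht01 : t ∈ Set.Icc (0 : ℝ) 1)
    (E : Set (Finset (Fin n) × Finset (Fin n))) {f : Finset (Fin n) → Finset (Fin n) → ℝ}
    (hf0 : ∀ Ω T, 0 ≤ f Ω T) (hf1 : ∀ Ω T, Ω.card = k → (Ω, T) ∈ E → 1 ≤ f Ω T) :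
    ((randomSet n k).prod (randomSet n l)).real E ≤ (n + 1) ^ 2 * selectorMean s t f := by
  classical
  have : IsFiniteMeasure (randomSet n k) := by unfold randomSet uniformOn; infer_instance
  have : IsFiniteMeasure (randomSet n l) := by unfold randomSet uniformOn; infer_instance
  have h := sum_measureReal_singleton (μ := (randomSet n k).prod (randomSet n l)) E.toFinset
  rw [Set.coe_toFinset] at h
  have hterm : ∀ u ∈ E.toFinset, ((randomSet n k).prod (randomSet n l)).real {u} ≤
      (n + 1) ^ 2 * (selectorWeight s u.1 * selectorWeight t u.2 * f u.1 u.2) := by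
    rintro ⟨Ω, T⟩ hu
    rw [← Set.singleton_prod_singleton, measureReal_prod_prod]
    have h1 := randomSet_real_singleton_le hkn hs hs01 Ω
    have h2 := randomSet_real_singleton_le hln ht ht01 T
    have h3 := selectorWeight_nonneg hs01 Ω
    have h4 := selectorWeight_nonneg ht01 T
    by_cases hΩ : Ω.card = k
    · have h5 := hf1 Ω T hΩ (Set.mem_toFinset.1 hu)
      calc _ ≤ ((n + 1) * selectorWeight s Ω) * ((n + 1) * selectorWeight t T) :=
            mul_le_mul h1 h2 measureReal_nonneg (by positivity)
        _ = (n + 1) ^ 2 * (selectorWeight s Ω * selectorWeight t T * 1) := by ring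
        _ ≤ _ := by gcongr
    · rw [randomSet_real_singleton, if_neg hΩ, zero_mul]
      have := hf0 Ω T
      positivity
  rw [← h]
  refine (Finset.sum_le_sum hterm).trans ?_
  rw [selectorMean, ← Fintype.sum_prod_type' (f := fun Ω T =>
    selectorWeight s Ω * selectorWeight t T * f Ω T), Finset.mul_sum]
  refine Finset.sum_le_sum_of_subset_of_nonneg (Finset.subset_univ _) fun u _ _ => ?_
  have h3 := selectorWeight_nonneg hs01 u.1
  have h4 := selectorWeight_nonneg ht01 u.2
  have h5 := hf0 u.1 u.2
  exact mul_nonneg (by positivity) (mul_nonneg (mul_nonneg h3 h4) h5)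

/-- For `|Ω| = δn` the event says that the squared norm is at least `81δ`. The order `2 * m` is even
so that the trace dominates the norm. -/
theorem normTailProb_le {n k l m : ℕ} (hm : 0 < m) (hkn : k < n) (hk : 0 < k) (hlk : l ≤ k)
    {δ θ : ℝ} (hδ : δ * n = k) (hθ : θ * k = l) (hδ01 : δ ∈ Set.Icc (0 : ℝ) 1)
    (hθ01 : θ ∈ Set.Icc (0 : ℝ) 1) (A : Matrix (Fin n) (Fin n) ℂ) :
    normTailProb A k l 9 ≤
      (n + 1) ^ 2 * (selectorMean δ (θ * δ) (traceMoment A (2 * m)) / (81 * δ) ^ (2 * m)) := by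
  have hn : (0 : ℝ) < n := Nat.cast_pos.2 (by omega)
  have hk' : (0 : ℝ) < k := Nat.cast_pos.2 hk
  have hδ0 : 0 < δ := by
    rcases hδ01.1.eq_or_lt with h | h
    · rw [← h, zero_mul] at hδ
      exact absurd hδ hk'.ne
    · exact h
  have hF : ∀ Ω T, ‖restrict A Ω T‖ ^ (2 * (2 * m)) ≤ traceMoment A (2 * m) Ω T := fun Ω T =>
    (pow_le_pow_left₀ (norm_nonneg _) (norm_restrict_le A Ω T) _).trans
      (norm_pow_le_traceMoment A Ω T hm)
  have h := prod_randomSet_real_le (k := k) (l := l) (s := δ) (t := θ * δ) hkn (by omega) hδ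
    (by rw [mul_assoc, hδ, hθ]) hδ01
    ⟨mul_nonneg hθ01.1 hδ01.1, mul_le_one₀ hθ01.2 hδ01.1 hδ01.2⟩
    {u | 9 ≤ Real.sqrt ((n : ℝ) / (u.1.card : ℝ)) * ‖restrict A u.1 u.2‖}
    (f := fun Ω T => traceMoment A (2 * m) Ω T / (81 * δ) ^ (2 * m))
    (fun Ω T => div_nonneg ((pow_nonneg (norm_nonneg _) _).trans (hF Ω T))
      (pow_nonneg (by positivity) _))
    (fun Ω T hΩ hE => by
      rw [one_le_div (by positivity)]
      refine le_trans ?_ (hF Ω T)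
      rw [pow_mul ‖restrict A Ω T‖]
      refine pow_le_pow_left₀ (by positivity) ?_ _
      have hE' : 9 ≤ Real.sqrt ((n : ℝ) / (Ω.card : ℝ)) * ‖restrict A Ω T‖ := hE
      have h2 := pow_le_pow_left₀ (by norm_num : (0 : ℝ) ≤ 9) hE' 2
      rw [mul_pow, Real.sq_sqrt (by positivity), hΩ, ← hδ] at h2
      rw [show (n : ℝ) / (δ * n) = δ⁻¹ by field_simp, inv_mul_eq_div, le_div_iff₀ hδ0] at h2
      linarith)
  refine h.trans (le_of_eq ?_)
  congr 1
  simp only [selectorMean, Finset.sum_div, mul_div_assoc]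

end Uniform

/-! ### Choice of the moment order and numerical estimates. -/

section Asymptotics

open Filter

/-- Powers of `log n` are `o(n)`. With `η = (δ/2)^r`, raising this to the power `q` yields `ε ≤ n
(δ/2)^p`. -/
theorem eventually_moment_order (r : ℕ) (K : ℝ) {η : ℝ} (hη : 0 < η) (hK : 0 < K) :
    ∀ᶠ n : ℕ in atTop, ((r * ⌈K * Real.log n⌉₊ : ℕ) + 1 : ℝ) ^ (2 * r) ≤ n * η := by
  set B : ℝ := r * (K + 1) + 1 with hB
  have hB0 : 0 < B := by positivity
  have h := (isLittleO_log_rpow_rpow_atTop ((2 * r : ℕ) : ℝ) (zero_lt_one)).comp_tendsto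
    tendsto_natCast_atTop_atTop
  have h1 := h.bound (show 0 < η / B ^ (2 * r) by positivity)
  have h2 : ∀ᶠ n : ℕ in atTop, 1 ≤ Real.log n :=
    (Real.tendsto_log_atTop.comp tendsto_natCast_atTop_atTop).eventually_ge_atTop 1
  filter_upwards [h1, h2] with n hn1 hn2
  simp only [Function.comp_apply, Real.rpow_natCast, Real.rpow_one, norm_pow, Real.norm_natCast]
    at hn1
  rw [Real.norm_of_nonneg (by linarith)] at hn1
  have h3 : ((r * ⌈K * Real.log n⌉₊ : ℕ) + 1 : ℝ) ≤ B * Real.log n := by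
    have h4 := (Nat.ceil_lt_add_one (show 0 ≤ K * Real.log n by positivity)).le
    push_cast
    have h5 : (⌈K * Real.log n⌉₊ : ℝ) ≤ (K + 1) * Real.log n := by linarith
    have h6 := mul_le_mul_of_nonneg_left h5 (Nat.cast_nonneg (α := ℝ) r)
    rw [hB]
    linarith
  calc _ ≤ (B * Real.log n) ^ (2 * r) := pow_le_pow_left₀ (by positivity) h3 _
    _ = B ^ (2 * r) * Real.log n ^ (2 * r) := mul_pow _ _ _
    _ ≤ B ^ (2 * r) * (η / B ^ (2 * r) * n) := by gcongr
    _ = n * η := by field_simp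

/-- The factor 3 comes from `log (2/3) ≤ -1/3`; the 4 pays for the polynomial loss `n ^ 4`. -/
theorem two_thirds_pow_ceil_le (C : ℝ) {n : ℕ} (hn : 0 < n) :
    (2 / 3 : ℝ) ^ ⌈3 * (C + 4) * Real.log n⌉₊ ≤ (n : ℝ) ^ (-C) / n ^ 4 := by
  have hn' : (0 : ℝ) < n := Nat.cast_pos.2 hn
  have hlog : 0 ≤ Real.log n := Real.log_natCast_nonneg n
  have h1 : Real.log (2 / 3) ≤ -(1 / 3) := by
    have := Real.log_le_sub_one_of_pos (show (0 : ℝ) < 2 / 3 by norm_num)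
    linarith
  have h2 := Nat.le_ceil (3 * (C + 4) * Real.log n)
  set q := ⌈3 * (C + 4) * Real.log n⌉₊
  rw [← Real.rpow_natCast (n : ℝ) 4, ← Real.rpow_sub hn', ← Real.rpow_natCast,
    Real.rpow_def_of_pos (by norm_num), Real.rpow_def_of_pos hn']
  refine Real.exp_le_exp.2 ?_
  have h3 : Real.log (2 / 3) * q ≤ -(1 / 3) * q := by gcongr
  push_cast
  nlinarith

theorem tail_estimate {n q r : ℕ} {δ ε : ℝ} (hn : 24 ≤ n) (hδ0 : 0 < δ) (hδ1 : δ ≤ 1) (hr : 0 < r)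
    (hrδ : δ⁻¹ ≤ (3 / 2) ^ r) (hq : ((r * q : ℕ) + 1 : ℝ) ^ (2 * r) ≤ n * (δ / 2) ^ r)
    (hε : ε = n * (((r * q : ℕ) + 1 : ℝ) ^ (2 * (r * q)) / n ^ q)) :
    (n + 1 : ℝ) ^ 2 * ((ε + δ ^ (r * q - q) * (6 ^ (2 * (r * q)) * (n + ε))) /
      (81 * δ) ^ (r * q)) ≤ n ^ 4 * (2 / 3) ^ q := by
  have hn' : (24 : ℝ) ≤ n := by exact_mod_cast hn
  have hn0 : (0 : ℝ) < n := by linarith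
  set p := r * q with hp
  have hqp : q ≤ p := Nat.le_mul_of_pos_left q hr
  have hε0 : 0 ≤ ε := by rw [hε]; positivity
  have hε1 : ε ≤ n * (δ / 2) ^ p := by
    rw [hε]
    gcongr
    rw [div_le_iff₀ (by positivity), ← mul_assoc, pow_mul, mul_comm ((δ / 2) ^ p)]
    calc _ = (((p + 1 : ℝ)) ^ (2 * r)) ^ q := by rw [← pow_mul, mul_assoc]
      _ ≤ (n * (δ / 2) ^ r) ^ q := pow_le_pow_left₀ (by positivity) hq q
      _ = _ := by rw [mul_pow, ← pow_mul]
  have hε2 : ε ≤ n := hε1.trans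
    (mul_le_of_le_one_right hn0.le (pow_le_one₀ (by positivity) (by linarith)))
  have h1 : ε / (81 * δ) ^ p ≤ n * (2 / 3) ^ q := by
    rw [div_le_iff₀ (by positivity)]
    calc ε ≤ n * (δ / 2) ^ p := hε1
      _ = n * ((2 / 3) ^ p * (3 / 4 * δ) ^ p) := by rw [← mul_pow]; congr 2; ring
      _ ≤ n * ((2 / 3) ^ q * (81 * δ) ^ p) := by
          gcongr ?_ * (?_ * ?_ ^ p)
          · exact pow_le_pow_of_le_one (by norm_num) (by norm_num) hqp
          · linarith
      _ = _ := by ring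
  have h2 : δ ^ (p - q) * (6 ^ (2 * p) * (n + ε)) / (81 * δ) ^ p ≤ 2 * n * (2 / 3) ^ q := by
    rw [div_le_iff₀ (by positivity)]
    -- The missing `q` powers of `δ` cost at most `(3/2)^(rq) = (3/2)^p`.
    have h3 : δ ^ (p - q) ≤ δ ^ p * (3 / 2) ^ p := by
      rw [show δ ^ p = δ ^ (p - q) * δ ^ q by rw [← pow_add, Nat.sub_add_cancel hqp], mul_assoc]
      refine le_mul_of_one_le_right (by positivity) ?_
      have h4 := pow_le_pow_left₀ (by positivity) hrδ q
      rw [← pow_mul, inv_pow, ← hp] at h4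
      rwa [← inv_le_iff_one_le_mul₀' (by positivity)]
    calc _ ≤ (δ ^ p * (3 / 2) ^ p) * (6 ^ (2 * p) * (n + n)) := by gcongr
      _ = 2 * n * ((2 / 3) ^ p * (81 * δ) ^ p) := by
          rw [pow_mul 6 2 p, ← mul_pow (2 / 3)]
          rw [show (δ ^ p * (3 / 2) ^ p) * ((6 ^ 2) ^ p * (n + n : ℝ)) =
            2 * n * (δ ^ p * (3 / 2) ^ p * (6 ^ 2) ^ p) by ring, ← mul_pow, ← mul_pow]
          congr 2
          ring
      _ ≤ 2 * n * ((2 / 3) ^ q * (81 * δ) ^ p) := by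
          gcongr ?_ * (?_ * ?_)
          exact pow_le_pow_of_le_one (by norm_num) (by norm_num) hqp
      _ = _ := by ring
  rw [add_div]
  calc _ ≤ (n + 1 : ℝ) ^ 2 * (n * (2 / 3) ^ q + 2 * n * (2 / 3) ^ q) := by gcongr
    _ = ((n + 1 : ℝ) ^ 2 * (3 * n)) * (2 / 3) ^ q := by ring
    _ ≤ n ^ 4 * (2 / 3) ^ q := by
        gcongr
        nlinarith [mul_pos hn0 hn0, mul_nonneg (mul_pos hn0 hn0).le (sub_nonneg.2 hn'),
          mul_nonneg (mul_pos hn0 (mul_pos hn0 hn0)).le (sub_nonneg.2 hn')]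

end Asymptotics

end SpikesSines

/-! ### The main theorem: choice of parameters. -/

theorem theorem2p10 :
    ∃ c : ℝ, 0 < c ∧ ∀ C : ℝ, 0 < C → ∀ δ : ℝ, 0 < δ → δ < c →
      ∃ N : ℕ, ∀ n : ℕ, N ≤ n → ∀ k l : ℕ, (k : ℝ) = δ * n → l ≤ k →
        SpikesSines.normTailProb (SpikesSines.dftMatrix n) k l 9 ≤ (n : ℝ) ^ (-C) ∧
        ∀ A : Matrix (Fin n) (Fin n) ℂ, ‖A‖ ≤ 1 →
          (∀ i j, ‖A i j‖ ≤ (n : ℝ) ^ (-(1 / 2) : ℝ)) →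
          SpikesSines.normTailProb A k l 9 ≤ (n : ℝ) ^ (-C) := by
  open SpikesSines in
  -- Any `δ < 1` is admissible; strictness gives `k < n`.
  refine ⟨1, one_pos, fun C hC δ hδ0 hδ1 => ?_⟩
  obtain ⟨r₀, hr₀⟩ := pow_unbounded_of_one_lt δ⁻¹ (show (1 : ℝ) < 3 / 2 by norm_num)
  -- Even and positive, so that `p = r * q` has the form `2 * m` with `m > 0`.
  set r := 2 * (r₀ + 1) with hr
  have hrδ : δ⁻¹ ≤ (3 / 2 : ℝ) ^ r :=
    hr₀.le.trans (pow_le_pow_right₀ (by norm_num) (by omega))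
  obtain ⟨N, hN⟩ := Filter.eventually_atTop.1
    (eventually_moment_order r (3 * (C + 4)) (η := (δ / 2) ^ r) (by positivity) (by positivity))
  refine ⟨max N 24, fun n hn k l hk hlk => ?_⟩
  have hn24 : 24 ≤ n := (le_max_right _ _).trans hn
  have hn0 : (0 : ℝ) < n := Nat.cast_pos.2 (by omega)
  have key : ∀ A : Matrix (Fin n) (Fin n) ℂ, ‖A‖ ≤ 1 →
      (∀ i j, ‖A i j‖ ≤ (n : ℝ) ^ (-(1 / 2) : ℝ)) → normTailProb A k l 9 ≤ (n : ℝ) ^ (-C) := by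
    intro A hA hb
    have hk0 : (0 : ℝ) < k := by rw [hk]; positivity
    have hkn : k < n := by
      have : (k : ℝ) < n := by rw [hk]; exact mul_lt_of_lt_one_left hn0 hδ1
      exact_mod_cast this
    have hlk' : (l : ℝ) ≤ k := by exact_mod_cast hlk
    have hδ01 : δ ∈ Set.Icc (0 : ℝ) 1 := ⟨hδ0.le, hδ1.le⟩
    have hθ01 : (l / k : ℝ) ∈ Set.Icc (0 : ℝ) 1 := ⟨by positivity, (div_le_one hk0).2 hlk'⟩
    have hq := hN n ((le_max_left _ _).trans hn)
    have hqC := two_thirds_pow_ceil_le C (show 0 < n by omega)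
    have hq0 : 0 < ⌈3 * (C + 4) * Real.log n⌉₊ := Nat.ceil_pos.2
      (mul_pos (by positivity) (Real.log_pos (by exact_mod_cast (show 1 < n by omega))))
    set q := ⌈3 * (C + 4) * Real.log n⌉₊
    have hp : r * q = 2 * ((r₀ + 1) * q) := by rw [hr, mul_assoc]
    have h1 := normTailProb_le (m := (r₀ + 1) * q) (by positivity) hkn (by exact_mod_cast hk0) hlk
      hk.symm (div_mul_cancel₀ (l : ℝ) hk0.ne') hδ01 hθ01 A
    rw [← hp] at h1
    refine h1.trans (le_trans ?_ ((tail_estimate hn24 hδ0 hδ1.le (by omega) hrδ hq rfl).trans ?_))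
    · gcongr
      exact selectorMean_traceMoment_le (by omega) hA hb
        (Nat.le_mul_of_pos_left q (by omega)) hδ01 hθ01 rfl
    · rwa [le_div_iff₀ (by positivity), mul_comm] at hqC
  exact ⟨key _ (norm_dftMatrix_le n) fun i j => (norm_dftMatrix_apply n i j).le, key⟩
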